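/- Let $G$ be a finite graph (loops and multiple edges allowed, not necessarily connected) with a total ordering of its edge set $E(G)$. Let $q\ge 0$ be an integer, let $\beta\in\mathbb{C}$, and let $G$ be equipped with an interaction energy $J_e\in\mathbb{C}$ for each edge $e$ and a field vector $\boldsymbol{M}_v=(M_{v,1},\dots,M_{v,q})\in\mathbb{C}^q$ for each vertex $v$. The Potts model partition function is $$Z_{ext}(G)=\sum_{\sigma:V(G)\to\{1,\dots,q\}} e^{-\beta h(\sigma)},\qquad h(\sigma)=-\sum_{e=\{i,j\}\in E(G)}J_e\,\delta(\sigma_i,\sigma_j)-\sum_{v\in V(G)}\sum_{\alpha=1}^{q}M_{v,\alpha}\,\delta(\alpha,\sigma_v),$$ where $\delta$ is the Kronecker delta. A spanning tree of $G$ is a set $T\subseteq E(G)$ such that the spanning subgraph $(V(G),T)$ is acyclic and its restriction to each connected component of $G$ is connected; let $\mathcal{T}(G)$ be the set of spanning trees. For $T\in\mathcal{T}(G)$ and $e\in T$, the cut defined by $e$ is $\{f\in E(G): (T\setminus\{e\})\cup\{f\}\in\mathcal{T}(G)\}$; for $e\in E(G)\setminus T$, the cycle defined by $e$ is the unique cycle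 in $T\cup\{e\}$. Let $\mathcal{I_I}(G,T)$ be the set of internally inactive edges, that is, of those $e\in T$ that are not the smallest edge of the cut defined by $e$, and let $\mathcal{E_A}(G,T)$ be the set of externally active edges, that is, of those $e\in E(G)\setminus T$ that are the smallest edge of the cycle defined by $e$. Let $T/\mathcal{I_I}(G,T)$ be the graph obtained from $(V(G),T)$ by contracting the edges in $\mathcal{I_I}(G,T)$; the remaining edges keep their interaction energies, and the field vector of each vertex of the contracted graph is the sum of the field vectors of the vertices of $G$ that were merged into it. Then $$Z_{ext}(G)=\sum_{T\in\mathcal{T}(G)}\left(\prod_{e\in\mathcal{I_I}(G,T)}\left(e^{\beta J_e}-1\right)\right)\left(\prod_{e\in\mathcal{E_A}(G,T)}e^{\beta J_e}\right)Z_{ext}\bigl(T/\mathcal{I_I}(G,T)\bigr).$$ -/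

import Mathlib

open scoped Graph

namespace Potts

noncomputable section

variable {α β : Type*}

/-! Graphs are Mathlib's `Graph α β`: multigraphs in which loops and parallel edges are allowed,
with vertex set `V(G) : Set α` and edge set `E(G) : Set β`. All sums and products below are
finite ones as soon as `V(G)` and `E(G)` are finite. -/

/-! ### The Potts model with variable couplings and site-dependent field -/

/-- A state: an assignment of one of the `q` spins to every vertex. -/
abbrev State (G : Graph α β) (q : ℕ) : Type _ := V(G) → Fin q

open Classical in
/-- The Kronecker delta `δ(σ_i, σ_j)` of the spins at the ends `i`, `j` of the edge `e`
(it is `1` when `e` is a loop). -/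
def edgeDelta {q : ℕ} (G : Graph α β) (σ : State G q) (e : β) : ℂ :=
  if ∀ i j : V(G), G.IsLink e i j → σ i = σ j then 1 else 0

/-- `h(σ) = - ∑_{e = ij} J_e δ(σ_i, σ_j) - ∑_i ∑_a M_{i,a} δ(a, σ_i)`. -/
def hamiltonian {q : ℕ} (G : Graph α β) (J : β → ℂ) (M : α → Fin q → ℂ) (σ : State G q) : ℂ :=
  - (∑ᶠ e ∈ E(G), J e * edgeDelta G σ e)
    - ∑ᶠ i : V(G), ∑ a : Fin q, M i a * (if a = σ i then 1 else 0)

/-- The partition function `Z_ext(G) = ∑_σ exp(-b h(σ))`, where `b` is the inverse temperature. -/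
def zExt {q : ℕ} (b : ℂ) (G : Graph α β) (J : β → ℂ) (M : α → Fin q → ℂ) : ℂ :=
  ∑ᶠ σ : State G q, Complex.exp (-b * hamiltonian G J M σ)

/-! ### Contraction -/

/-- Two vertices are joined by a walk of `G`. -/
def Reach (G : Graph α β) : α → α → Prop := Relation.ReflTransGen G.Adj

/-- The set of vertices that are merged with `v` when the edges in `A` are contracted: the
vertex set of the component of `v` in the spanning subgraph `(V(G), A)`. -/
def block (G : Graph α β) (A : Set β) (v : α) : Set α := {w | Reach (G.restrict A) v w}

/-- The contraction `G / A` for the edge set `A` of a forest (so that no loop is contracted):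
the edges in `A` disappear, and a vertex of `G / A` is the set of the vertices of `G` that have
been merged into it. The other edges keep their names. -/
def contract (G : Graph α β) (A : Set β) : Graph (Set α) β :=
  (G.deleteEdges A).map (block G A)

/-- The field vector of a vertex of a contraction: the sum of the field vectors of the vertices
merged into it. -/
def mergedField {q : ℕ} (M : α → Fin q → ℂ) : Set α → Fin q → ℂ :=
  fun B => ∑ᶠ v ∈ B, M v

/-! ### Cycles, spanning trees, activities -/

/-- `C` is the edge set of a cycle of `G` of length `n + 1 ≥ 1`: the vertices `v 0, …, v n` are
distinct, the edges `c 0, …, c n` are distinct, and `c i` joins `v i` to the cyclically next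
vertex. Length one is a loop, length two a pair of parallel edges. -/
def IsCycleSet (G : Graph α β) (C : Set β) : Prop :=
  ∃ (n : ℕ) (v : Fin (n + 1) → α) (c : Fin (n + 1) → β),
    Function.Injective v ∧ Function.Injective c ∧
      (∀ i, G.IsLink (c i) (v i) (v (i + 1))) ∧ C = Set.range c

/-- The spanning subgraph `(V(G), F)` is a spanning forest of `G`. -/
def IsSpanningForest (G : Graph α β) (F : Set β) : Prop :=
  F ⊆ E(G) ∧ ∀ C, ¬ IsCycleSet (G.restrict F) C

/-- The spanning subgraph `(V(G), T)` is a spanning tree of `G`, i.e. a spanning forest that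
connects each component of `G`. -/
def IsSpanningTree (G : Graph α β) (T : Set β) : Prop :=
  IsSpanningForest G T ∧ ∀ u v, Reach G u v → Reach (G.restrict T) u v

/-- The cut defined by an edge `e` of the spanning tree `T`. -/
def cut (G : Graph α β) (T : Set β) (e : β) : Set β :=
  {f | f ∈ E(G) ∧ IsSpanningTree G ((T \ {e}) ∪ {f})}

/-- The cycle defined by an edge `e` outside the spanning tree `T`: the edges lying on a cycle
(there is exactly one) of `T ∪ {e}`. -/
def fundCycle (G : Graph α β) (T : Set β) (e : β) : Set β :=
  {f | ∃ C, IsCycleSet (G.restrict (T ∪ {e})) C ∧ f ∈ C}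

variable [LinearOrder β]

/-- The internally inactive edges of `T`: those that are not the smallest edge of their cut. -/
def internallyInactive (G : Graph α β) (T : Set β) : Set β :=
  {e | e ∈ T ∧ ¬ IsLeast (cut G T e) e}

/-- The externally active edges of `T`: those outside `T` that are the smallest edge of the cycle
that they define. -/
def externallyActive (G : Graph α β) (T : Set β) : Set β :=
  {e | e ∈ E(G) ∧ e ∉ T ∧ IsLeast (fundCycle G T e) e}

end

end Potts

/-! A Kronecker delta is `0` or `1`, so `exp (b J_e δ) = 1 + x_e` with `x_e = (exp (b J_e) - 1) δ`,
and each state contributes `∏ (1 + x_e)` times a field factor. Expanding gives a sum over edge sets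
`A`, which Crapo's theorem (`existsUnique_basis_interval`) groups: every `A` lies between `I` and `T
∪ O` for exactly one spanning tree `T`, where `I` are its internally inactive and `O` its externally
active edges. Hence the product is the sum over `T` of `∏_I x · ∏_O (1 + x) · ∏_{T \ I} (1 + x)`
(`prod_one_add_eq_sum_bases`).

The factor `∏_I x` vanishes unless the state is constant along `I`. Such states are the states of `T
/ I` (`range_pullState`). The ends of an edge in `O` are joined by edges in `I`
(`activeOut_subset_closure`), so its factor is `exp (b J_e)`, and what remains sums to the partition
function of `T / I` (`zExt_contract`).

Crapo's theorem is proved for a closure operator with exchange: `A` lies in the interval of `T`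
exactly when `T` is optimal for a linear order built from `A` (`mem_interval_iff_optimal`), and the
optimal basis exists and is unique. Spanning trees are the bases of `cycleClosure`
(`isSpanningTree_iff`). -/

namespace Potts

/-! ### Bases of a closure operator with the exchange property -/

section Closure

variable {β γ : Type*} [LinearOrder γ] {c : ClosureOperator (Set β)} {E T : Set β} {e f : β}

/-- The Mac Lane–Steinitz exchange property. -/
def HasExchange (c : ClosureOperator (Set β)) : Prop :=
  ∀ S e f, e ∈ c (insert f S) → e ∉ c S → f ∈ c (insert e S)

/-- `T` is an independent subset of `E` that spans `E`. -/
structure IsClosureBasis (c : ClosureOperator (Set β)) (E T : Set β) : Prop where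
  subset : T ⊆ E
  spans : E ⊆ c T
  indep : ∀ e ∈ T, e ∉ c (T \ {e})

/-- `e ∈ T` may be replaced by `f ∈ E \ T` in the basis `T`. -/
structure Exchanges (c : ClosureOperator (Set β)) (E T : Set β) (e f : β) : Prop where
  mem : e ∈ T
  mem_ground : f ∈ E
  notMem : f ∉ T
  mem_closure : e ∈ c (insert f (T \ {e}))

lemma closure_mono (c : ClosureOperator (Set β)) {S U : Set β} (h : S ⊆ U) (he : e ∈ c S) :
    e ∈ c U :=
  c.monotone h he

lemma closure_le_of_subset (c : ClosureOperator (Set β)) {S U : Set β} (h : S ⊆ c U) :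
    c S ⊆ c U := by
  have := c.monotone h
  rwa [c.idempotent] at this

lemma subset_closure_of_subset (c : ClosureOperator (Set β)) {S U : Set β} (h : S ⊆ U) :
    S ⊆ c U :=
  h.trans (c.le_closure U)

/-- Take `S` minimal among the subsets of `X` spanning `e`: dropping any `g` loses `e`, so exchange
applies. `S` plays the role of a circuit through `e`, without `e` itself. -/
lemma exists_circuit (hc : HasExchange c) {X : Set β} (hX : X.Finite) (he : e ∈ c X) :
    ∃ S ⊆ X, e ∈ c S ∧ ∀ g ∈ S, g ∈ c (insert e (S \ {g})) := by
  have hfin : {S : Set β | S ⊆ X ∧ e ∈ c S}.Finite :=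
    hX.finite_subsets.subset fun S hS => hS.1
  obtain ⟨S, hS⟩ := hfin.exists_minimal ⟨X, subset_rfl, he⟩
  refine ⟨S, hS.prop.1, hS.prop.2, fun g hg => ?_⟩
  have hins : insert g (S \ {g}) = S := by simp [hg]
  refine hc _ _ _ (by rw [hins]; exact hS.prop.2) fun hmem => ?_
  have := hS.le_of_le ⟨Set.sdiff_subset.trans hS.prop.1, hmem⟩ Set.sdiff_subset hg
  exact this.2 rfl

lemma IsClosureBasis.exchange_iff (hc : HasExchange c) (hT : IsClosureBasis c E T)
    (he : e ∈ T) (hf : f ∈ E) (hfT : f ∉ T) :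
    IsClosureBasis c E ((T \ {e}) ∪ {f}) ↔ Exchanges c E T e f := by
  rw [Set.union_singleton]
  refine ⟨fun h => ⟨he, hf, hfT, h.spans (hT.subset he)⟩, fun h => ?_⟩
  have hins : insert e (T \ {e}) = T := by simp [he]
  have hnf : f ∉ c (T \ {e}) := fun hmem => hT.indep e he <|
    closure_le_of_subset c (Set.insert_subset hmem (c.le_closure _)) h.mem_closure
  refine ⟨Set.insert_subset hf (Set.sdiff_subset.trans hT.subset), hT.spans.trans ?_, ?_⟩
  · apply closure_le_of_subset
    nth_rw 1 [← hins]
    exact Set.insert_subset h.mem_closure (subset_closure_of_subset c (Set.subset_insert _ _))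
  · intro g hg hmem
    rcases eq_or_ne g f with rfl | hgf
    · refine hnf (closure_mono c ?_ hmem)
      rintro x ⟨hx | hx, hxg⟩
      · exact (hxg hx).elim
      · exact hx
    · have hgS : g ∈ T \ {e} := hg.resolve_left hgf
      have h1 : (insert f (T \ {e})) \ {g} = insert f ((T \ {e}) \ {g}) := by
        ext x
        simp only [Set.mem_sdiff, Set.mem_insert_iff, Set.mem_singleton_iff]
        constructor
        · tauto
        · rintro (rfl | h)
          · exact ⟨Or.inl rfl, hgf.symm⟩
          · tauto
      rw [h1] at hmem
      have h2 := hc _ _ _ hmem fun h' => hT.indep g hgS.1 <|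
        closure_mono c (Set.sdiff_subset_sdiff_left Set.sdiff_subset) h'
      rw [Set.insert_sdiff_singleton, Set.insert_eq_of_mem hgS] at h2
      exact hnf h2

lemma IsClosureBasis.exists_exchange_circuit (hc : HasExchange c) (hE : E.Finite)
    (hT : IsClosureBasis c E T) (hf : f ∈ E) (hfT : f ∉ T) :
    ∃ S ⊆ T, f ∈ c S ∧ ∀ g ∈ S, Exchanges c E T g f := by
  obtain ⟨S, hST, hfS, hS⟩ := exists_circuit hc (hE.subset hT.subset) (hT.spans hf)
  exact ⟨S, hST, hfS, fun g hg => ⟨hST hg, hf, hfT,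
    closure_mono c (Set.insert_subset_insert (Set.sdiff_subset_sdiff_left hST)) (hS g hg)⟩⟩

/-- The greedy algorithm yields a basis that no exchange improves. -/
lemma exists_optimal_basis (hc : HasExchange c) (hE : E.Finite) (w : β → γ)
    (hw : Function.Injective w) :
    ∃ T, IsClosureBasis c E T ∧ ∀ e f, Exchanges c E T e f → w e ≤ w f := by
  -- The greedy rule: keep an element unless lighter ones span it.
  set T : Set β := {e | e ∈ E ∧ e ∉ c {f | f ∈ E ∧ w f < w e}} with hTdef
  have hTE : T ⊆ E := fun e he => he.1
  have hwf : E.WellFoundedOn fun a b => w a < w b := by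
    have : IsStrictOrder β fun a b => w a < w b :=
      { irrefl := fun a => lt_irrefl _, trans := fun a b c => lt_trans }
    exact hE.wellFoundedOn
  have hlt : ∀ e ∈ E, e ∉ T → e ∈ c {f | f ∈ T ∧ w f < w e} := by
    intro e he
    refine hwf.induction (P := fun e => e ∉ T → e ∈ c {f | f ∈ T ∧ w f < w e}) he ?_
    intro e he ih heT
    have h1 : e ∈ c {f | f ∈ E ∧ w f < w e} := by
      by_contra h
      exact heT ⟨he, h⟩
    refine closure_le_of_subset c ?_ h1
    rintro f ⟨hf, hfe⟩
    by_cases hfT : f ∈ T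
    · exact c.le_closure _ ⟨hfT, hfe⟩
    · exact closure_mono c (fun g hg => ⟨hg.1, hg.2.trans hfe⟩) (ih f hf hfe hfT)
  have hindep : ∀ e ∈ T, e ∉ c (T \ {e}) := by
    intro e heT hmem
    obtain ⟨S, hST, heS, hS⟩ := exists_circuit hc (hE.subset (Set.sdiff_subset.trans hTE)) hmem
    by_cases hall : ∀ g ∈ S, w g < w e
    · exact heT.2 (closure_mono c (fun g hg => ⟨hTE (hST hg).1, hall g hg⟩) heS)
    · push Not at hall
      obtain ⟨g₀, hg₀, hg₀e⟩ := hall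
      -- The heaviest member `g` of the circuit is spanned by lighter elements, so the greedy rule
      -- would have rejected it.
      obtain ⟨g, hg, hmax⟩ := (hE.subset (hST.trans (Set.sdiff_subset.trans hTE))).exists_maximalFor
        w S ⟨g₀, hg₀⟩
      have hle : ∀ x ∈ S, w x ≤ w g := fun x hx => by
        rcases le_total (w x) (w g) with h | h
        · exact h
        · exact hmax hx h
      refine (hST hg).1.2 (closure_mono c ?_ (hS g hg))
      apply Set.insert_subset
      · refine ⟨heT.1, lt_of_le_of_ne (hg₀e.trans (hle _ hg₀)) fun h => ?_⟩
        exact (hST hg).2 (hw h).symm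
      · rintro x ⟨hx, hxg⟩
        exact ⟨hTE (hST hx).1, lt_of_le_of_ne (hle x hx) fun h => hxg (hw h)⟩
  refine ⟨T, ⟨hTE, fun e he => ?_, hindep⟩, fun e f h => ?_⟩
  · by_cases heT : e ∈ T
    · exact c.le_closure _ heT
    · exact closure_mono c (fun g hg => hg.1) (hlt e he heT)
  · by_contra hlt'
    push Not at hlt'
    -- `f` is spanned by lighter members of `T`, and the heavier `e` is not among them.
    have hf : f ∈ c (T \ {e}) := closure_mono c
      (fun g hg => ⟨hg.1, by rintro rfl; exact absurd hg.2 (not_lt.2 hlt'.le)⟩)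
      (hlt f h.mem_ground h.notMem)
    exact hindep e h.mem
      (closure_le_of_subset c (Set.insert_subset hf (c.le_closure _)) h.mem_closure)

/-- Consider the lightest `e` on which the bases differ. Its circuit in the other basis must leave
the basis containing `e`, and by optimality it does so at a lighter element. -/
lemma optimal_basis_unique (hc : HasExchange c) (hE : E.Finite) (w : β → γ)
    (hw : Function.Injective w) {T₁ T₂ : Set β}
    (hT₁ : IsClosureBasis c E T₁) (hT₂ : IsClosureBasis c E T₂)
    (h₁ : ∀ e f, Exchanges c E T₁ e f → w e ≤ w f)
    (h₂ : ∀ e f, Exchanges c E T₂ e f → w e ≤ w f) : T₁ = T₂ := by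
  have key : ∀ {A B : Set β}, IsClosureBasis c E A → IsClosureBasis c E B →
      (∀ e f, Exchanges c E B e f → w e ≤ w f) → ∀ e ∈ A, e ∉ B →
      ∃ g ∈ B, g ∉ A ∧ w g < w e := by
    intro A B hA hB hopt e heA heB
    obtain ⟨S, hSB, heS, hS⟩ := hB.exists_exchange_circuit hc hE (hA.subset heA) heB
    by_contra! hcon
    refine hA.indep e heA (closure_mono c (fun g hg => ?_) heS)
    have hge : g ≠ e := by rintro rfl; exact heB (hSB hg)
    refine ⟨?_, hge⟩
    by_contra hgA
    exact hge (hw (le_antisymm (hopt g e (hS g hg)) (hcon g (hSB hg) hgA)))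
  by_contra hne
  have hfin : ((T₁ \ T₂) ∪ (T₂ \ T₁)).Finite :=
    hE.subset (Set.union_subset (Set.sdiff_subset.trans hT₁.subset)
      (Set.sdiff_subset.trans hT₂.subset))
  have hnon : ((T₁ \ T₂) ∪ (T₂ \ T₁)).Nonempty := by
    by_contra hemp
    rw [Set.not_nonempty_iff_eq_empty, Set.union_empty_iff, Set.sdiff_eq_empty,
      Set.sdiff_eq_empty] at hemp
    exact hne (hemp.1.antisymm hemp.2)
  obtain ⟨e, he, hmin⟩ := hfin.exists_minimalFor w _ hnon
  rcases he with he | he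
  · obtain ⟨g, hg, hgn, hlt⟩ := key hT₁ hT₂ h₂ e he.1 he.2
    exact not_le.2 hlt (hmin (Or.inr ⟨hg, hgn⟩) hlt.le)
  · obtain ⟨g, hg, hgn, hlt⟩ := key hT₂ hT₁ h₁ e he.1 he.2
    exact not_le.2 hlt (hmin (Or.inl ⟨hg, hgn⟩) hlt.le)

/-! ### Activities and Crapo's intervals -/

open Classical in
/-- Members of `A` come first, in decreasing order, and the other elements after them, in
increasing order. -/
noncomputable def activityWeight (A : Set β) (e : β) : βᵒᵈ ⊕ₗ β :=
  if e ∈ A then Sum.inlₗ (OrderDual.toDual e) else Sum.inrₗ e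

lemma activityWeight_injective (A : Set β) : Function.Injective (activityWeight A) := by
  intro e f h
  unfold activityWeight at h
  split_ifs at h <;> simp at h <;> exact h

variable [LinearOrder β]

/-- Elements of `T` that some smaller element can replace. -/
def inactiveIn (c : ClosureOperator (Set β)) (E T : Set β) : Set β :=
  {e | e ∈ T ∧ ∃ f, Exchanges c E T e f ∧ f < e}

/-- Elements outside `T` that can only replace larger elements. -/
def activeOut (c : ClosureOperator (Set β)) (E T : Set β) : Set β :=
  {f | f ∈ E ∧ f ∉ T ∧ ∀ e, Exchanges c E T e f → f < e}

/-- The active `f` is smaller than every element it can replace, so all other members of its circuit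
are inactive. -/
lemma activeOut_subset_closure (hc : HasExchange c) (hE : E.Finite)
    (hT : IsClosureBasis c E T) : activeOut c E T ⊆ c (inactiveIn c E T) := by
  rintro f ⟨hf, hfT, hact⟩
  obtain ⟨S, hST, hfS, hS⟩ := hT.exists_exchange_circuit hc hE hf hfT
  exact closure_mono c (fun g hg => ⟨hST hg, f, hS g hg, hact g (hS g hg)⟩) hfS

/-- Compare `e` and `f` by membership in `A`. Outside `A` the order increases, so an inactive `e ∉
A` would be improved by an exchange; inside `A` it decreases, which forces `f ∈ A \ T` to be active.
With only `e` in `A` nothing is required; with only `f` in `A` the interval condition would give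
both `f < e` and `e < f`. -/
lemma mem_interval_iff_optimal {A : Set β} (hA : A ⊆ E) :
    (inactiveIn c E T ⊆ A ∧ A ⊆ T ∪ activeOut c E T) ↔
      ∀ e f, Exchanges c E T e f → activityWeight A e ≤ activityWeight A f := by
  constructor
  · rintro ⟨hin, hout⟩ e f h
    have hfe : f ∈ A → f < e := fun hf => ((hout hf).resolve_left h.notMem).2.2 e h
    have hne : e ≠ f := fun h' => h.notMem (h' ▸ h.mem)
    have hef : e ∉ A → e < f := fun he => by
      by_contra hlt
      exact he (hin ⟨h.mem, f, h, lt_of_le_of_ne (not_lt.1 hlt) hne.symm⟩)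
    by_cases he : e ∈ A <;> by_cases hf : f ∈ A
    · simpa [activityWeight, he, hf] using (hfe hf).le
    · simp [activityWeight, he, hf]
    · exact absurd (hfe hf) (hef he).le.not_gt
    · simpa [activityWeight, he, hf] using (hef he).le
  · intro hopt
    constructor
    · rintro e ⟨heT, f, h, hlt⟩
      by_contra he
      have := hopt e f h
      by_cases hf : f ∈ A
      · simp only [activityWeight, he, hf, if_true, if_false] at this
        exact Sum.Lex.not_inr_le_inl this
      · simp only [activityWeight, he, hf, if_false] at this
        exact absurd (Sum.Lex.inr_le_inr_iff.1 this) hlt.not_ge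
    · intro f hf
      by_cases hfT : f ∈ T
      · exact Or.inl hfT
      refine Or.inr ⟨hA hf, hfT, fun e h => ?_⟩
      have := hopt e f h
      have hne : f ≠ e := fun h' => h.notMem (h' ▸ h.mem)
      by_cases he : e ∈ A
      · simp only [activityWeight, he, hf, if_true] at this
        exact lt_of_le_of_ne (OrderDual.toDual_le_toDual.1 (Sum.Lex.inl_le_inl_iff.1 this)) hne
      · simp only [activityWeight, he, hf, if_true, if_false] at this
        exact absurd this Sum.Lex.not_inr_le_inl

/-- Crapo's theorem: the intervals `[inactiveIn, T ∪ activeOut]` partition the subsets of `E`. -/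
lemma existsUnique_basis_interval (hc : HasExchange c) (hE : E.Finite) {A : Set β} (hA : A ⊆ E) :
    ∃! T, IsClosureBasis c E T ∧ inactiveIn c E T ⊆ A ∧ A ⊆ T ∪ activeOut c E T := by
  obtain ⟨T, hT, hopt⟩ := exists_optimal_basis hc hE _ (activityWeight_injective A)
  refine ⟨T, ⟨hT, (mem_interval_iff_optimal hA).2 hopt⟩, ?_⟩
  rintro T' ⟨hT', h'⟩
  exact optimal_basis_unique hc hE _ (activityWeight_injective A) hT' hT
    ((mem_interval_iff_optimal hA).1 h') hopt

open Classical in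
/-- The expansion of `∏ (1 + x e)` over the bases of a finite set. -/
lemma prod_one_add_eq_sum_bases {R : Type*} [CommRing R] (hc : HasExchange c)
    (E : Finset β) (x : β → R) :
    ∏ e ∈ E, (1 + x e) =
      ∑ T ∈ E.powerset.filter (fun T : Finset β => IsClosureBasis c E (T : Set β)),
        (∏ e ∈ T with e ∈ inactiveIn c E T, x e) *
          ((∏ e ∈ E with e ∈ activeOut c E T, (1 + x e)) *
            ∏ e ∈ T with e ∉ inactiveIn c E T, (1 + x e)) := by
  rw [Finset.prod_one_add]
  have hterm : ∀ T : Finset β, T ∈ E.powerset → (∏ e ∈ T with e ∈ inactiveIn c E T, x e) *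
          ((∏ e ∈ E with e ∈ activeOut c E T, (1 + x e)) *
            ∏ e ∈ T with e ∉ inactiveIn c E T, (1 + x e)) =
      ∑ A ∈ E.powerset.filter (fun A : Finset β => inactiveIn c E T ⊆ (A : Set β) ∧
        (A : Set β) ⊆ T ∪ activeOut c E T), ∏ e ∈ A, x e := by
    intro T hT
    rw [Finset.mem_powerset] at hT
    have hdisj : Disjoint (E.filter (· ∈ activeOut c E T))
        (T.filter (· ∉ inactiveIn c E T)) := by
      rw [Finset.disjoint_left]
      intro e he heT
      exact (Finset.mem_filter.1 he).2.2.1 (Finset.mem_filter.1 heT).1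
    rw [← Finset.prod_union hdisj, Finset.prod_one_add, Finset.mul_sum]
    have hd : ∀ R ∈ (E.filter (· ∈ activeOut c E T) ∪ T.filter (· ∉ inactiveIn c E T)).powerset,
        Disjoint (T.filter (· ∈ inactiveIn c E T)) R := by
      intro R hR
      rw [Finset.disjoint_left]
      intro e he heR
      have := Finset.mem_powerset.1 hR heR
      rw [Finset.mem_filter] at he
      rcases Finset.mem_union.1 this with h | h
      · exact (Finset.mem_filter.1 h).2.2.1 he.1
      · exact (Finset.mem_filter.1 h).2 he.2
    -- The members of the interval are the inactive part joined with an arbitrary subset `R` of the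
    -- remaining elements.
    refine Finset.sum_bij' (fun R _ => T.filter (· ∈ inactiveIn c E T) ∪ R)
      (fun A _ => A \ T.filter (· ∈ inactiveIn c E T)) ?_ ?_ ?_ ?_ ?_
    · intro R hR
      rw [Finset.mem_powerset] at hR
      rw [Finset.mem_filter, Finset.mem_powerset]
      refine ⟨Finset.union_subset ((Finset.filter_subset _ _).trans hT) (hR.trans
        (Finset.union_subset (Finset.filter_subset _ _)
          ((Finset.filter_subset _ _).trans hT))), fun e he => ?_, fun e he => ?_⟩
      · simp [he, show e ∈ T from he.1]
      · rcases Finset.mem_union.1 (Finset.mem_coe.1 he) with h | h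
        · exact Or.inl (Finset.mem_filter.1 h).1
        · rcases Finset.mem_union.1 (hR h) with h | h
          · exact Or.inr (Finset.mem_filter.1 h).2
          · exact Or.inl (Finset.mem_filter.1 h).1
    · intro A hA
      rw [Finset.mem_filter, Finset.mem_powerset] at hA
      rw [Finset.mem_powerset]
      intro e he
      rw [Finset.mem_sdiff, Finset.mem_filter] at he
      rw [Finset.mem_union, Finset.mem_filter, Finset.mem_filter]
      rcases hA.2.2 he.1 with h | h
      · exact Or.inr ⟨h, fun h' => he.2 ⟨h, h'⟩⟩
      · exact Or.inl ⟨hA.1 he.1, h⟩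
    · intro R hR
      rw [Finset.union_sdiff_cancel_left (hd R hR)]
    · intro A hA
      rw [Finset.mem_filter, Finset.mem_powerset] at hA
      refine Finset.union_sdiff_of_subset fun e he => ?_
      exact hA.2.1 (Finset.mem_filter.1 he).2
    · intro R hR
      rw [Finset.prod_union (hd R hR)]
  rw [Finset.sum_congr rfl fun T hT => hterm T (Finset.mem_filter.1 hT).1]
  -- With `A` outermost, the inner sum is constant and runs over the single basis whose interval
  -- contains `A`.
  rw [Finset.sum_comm' (t' := E.powerset) (s' := fun A => (E.powerset.filter fun T : Finset β =>
    IsClosureBasis c E (T : Set β) ∧ inactiveIn c E T ⊆ (A : Set β) ∧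
        (A : Set β) ⊆ T ∪ activeOut c E T))]
  · refine Finset.sum_congr rfl fun A hA => ?_
    rw [Finset.sum_const]
    rw [Finset.mem_powerset] at hA
    obtain ⟨T, hT, huniq⟩ := existsUnique_basis_interval hc E.finite_toSet
      (Finset.coe_subset.2 hA)
    have hfin := E.finite_toSet.subset hT.1.subset
    suffices h : (E.powerset.filter fun T : Finset β =>
        IsClosureBasis c E (T : Set β) ∧ inactiveIn c E T ⊆ (A : Set β) ∧
          (A : Set β) ⊆ T ∪ activeOut c E T) = {hfin.toFinset} by
      rw [h, Finset.card_singleton, one_smul]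
    ext T'
    rw [Finset.mem_filter, Finset.mem_singleton, Finset.mem_powerset]
    constructor
    · rintro ⟨-, h⟩
      rw [← Finset.coe_inj, Set.Finite.coe_toFinset]
      exact huniq _ h
    · rintro rfl
      rw [Set.Finite.coe_toFinset]
      exact ⟨by rw [Set.Finite.toFinset_subset]; exact hT.1.subset, hT⟩
  · intro T A
    simp only [Finset.mem_filter]
    tauto

end Closure

end Potts

namespace Potts

/-! ### The cycle closure of a graph -/

section GraphClosure

variable {α β : Type*} {G H : Graph α β} {e f : β} {u v w x y : α}

lemma Reach.symm (h : Reach G u v) : Reach G v u := by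
  induction h with
  | refl => exact .refl
  | tail _ hadj ih => exact .head hadj.symm ih

lemma Reach.trans (h : Reach G u v) (h' : Reach G v w) : Reach G u w :=
  Relation.ReflTransGen.trans h h'

lemma Reach.of_adj_imp (hadj : ∀ a b, G.Adj a b → Reach H a b) (h : Reach G u v) :
    Reach H u v := by
  induction h with
  | refl => exact .refl
  | tail _ hab ih => exact ih.trans (hadj _ _ hab)

lemma reach_of_isLink (h : G.IsLink e u v) : Reach G u v :=
  .single h.adj

lemma Reach.mono_restrict {S U : Set β} (hSU : S ⊆ U) (h : Reach (G.restrict S) u v) :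
    Reach (G.restrict U) u v :=
  h.of_adj_imp fun _ _ ⟨_, he⟩ => reach_of_isLink ⟨hSU he.1, he.2⟩

/-- The edges (and the labels that are no edges) whose ends are joined by edges in `S`. -/
def cycleClosure (G : Graph α β) : ClosureOperator (Set β) :=
  ClosureOperator.mk' (fun S => {e | ∀ x y, G.IsLink e x y → Reach (G.restrict S) x y})
    (fun _ _ hSU _ he x y hxy => (he x y hxy).mono_restrict hSU)
    (fun _ _ he _ _ hxy => reach_of_isLink ⟨he, hxy⟩)
    (fun _ _ he x y hxy => (he x y hxy).of_adj_imp fun _ _ ⟨_, hg⟩ => hg.1 _ _ hg.2)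

lemma mem_cycleClosure {S : Set β} :
    e ∈ cycleClosure G S ↔ ∀ x y, G.IsLink e x y → Reach (G.restrict S) x y :=
  Iff.rfl

lemma mem_cycleClosure_of_isLink {S : Set β} (h : G.IsLink e x y)
    (hxy : Reach (G.restrict S) x y) : e ∈ cycleClosure G S := by
  intro x' y' h'
  obtain ⟨rfl, rfl⟩ | ⟨rfl, rfl⟩ := h.eq_and_eq_or_eq_and_eq h'
  · exact hxy
  · exact hxy.symm

/-- One crossing of `f` suffices: everything between the first arrival at an end of `f` and the last
departure from one can be shortcut. -/
lemma Reach.of_insert {S : Set β} (hf : G.IsLink f x y)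
    (h : Reach (G.restrict (insert f S)) u v) :
    Reach (G.restrict S) u v ∨ (Reach (G.restrict S) u x ∧ Reach (G.restrict S) y v) ∨
      (Reach (G.restrict S) u y ∧ Reach (G.restrict S) x v) := by
  induction h with
  | refl => exact Or.inl .refl
  | tail _ hab ih =>
    obtain ⟨g, hg | hg, hlink⟩ := hab
    · subst hg
      obtain ⟨rfl, rfl⟩ | ⟨rfl, rfl⟩ := hlink.eq_and_eq_or_eq_and_eq hf
      · rcases ih with h | ⟨h, -⟩ | ⟨h, -⟩
        · exact Or.inr (Or.inl ⟨h, .refl⟩)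
        · exact Or.inr (Or.inl ⟨h, .refl⟩)
        · exact Or.inl h
      · rcases ih with h | ⟨h, -⟩ | ⟨h, -⟩
        · exact Or.inr (Or.inr ⟨h, .refl⟩)
        · exact Or.inl h
        · exact Or.inr (Or.inr ⟨h, .refl⟩)
    · have hstep : Reach (G.restrict S) _ _ := reach_of_isLink ⟨hg, hlink⟩
      rcases ih with h | ⟨h, h'⟩ | ⟨h, h'⟩
      · exact Or.inl (h.trans hstep)
      · exact Or.inr (Or.inl ⟨h, h'.trans hstep⟩)
      · exact Or.inr (Or.inr ⟨h, h'.trans hstep⟩)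

/-- If `f` is needed to join the ends of `e`, then `S` joins the ends of `f` to those of `e`, and
`e` bridges the gap. -/
lemma cycleClosure_hasExchange (G : Graph α β) : HasExchange (cycleClosure G) := by
  intro S e f he heS x y hf
  rw [mem_cycleClosure] at heS
  push Not at heS
  obtain ⟨u, v, huv, hnot⟩ := heS
  have hstep : Reach (G.restrict (insert e S)) u v :=
    reach_of_isLink ⟨Set.mem_insert _ _, huv⟩
  have hmono : ∀ {a b}, Reach (G.restrict S) a b → Reach (G.restrict (insert e S)) a b :=
    fun h => h.mono_restrict (Set.subset_insert _ _)
  rcases (he u v huv).of_insert hf with h | ⟨h, h'⟩ | ⟨h, h'⟩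
  · exact absurd h hnot
  · exact ((hmono h.symm).trans hstep).trans (hmono h'.symm)
  · exact (((hmono h.symm).trans hstep).trans (hmono h'.symm)).symm

/-! ### Cycles and spanning trees in terms of the closure -/

/-- A shortest walk has distinct vertices. -/
lemma Reach.exists_injOn_walk (h : Reach G u v) :
    ∃ (n : ℕ) (p : ℕ → α), p 0 = u ∧ p n = v ∧ (∀ i < n, G.Adj (p i) (p (i + 1))) ∧
      ∀ i j, i < j → j ≤ n → p i ≠ p j := by
  have hex : ∃ n, ∃ p : ℕ → α, p 0 = u ∧ p n = v ∧ ∀ i < n, G.Adj (p i) (p (i + 1)) := by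
    induction h with
    | refl => exact ⟨0, fun _ => u, rfl, rfl, by simp⟩
    | @tail a b _ hab ih =>
      obtain ⟨n, p, h0, hn, hp⟩ := ih
      refine ⟨n + 1, fun i => if i ≤ n then p i else b, by simp [h0], by simp, fun i hi => ?_⟩
      rcases (Nat.lt_succ_iff.1 hi).lt_or_eq with hlt | rfl
      · simpa [hlt.le, Nat.succ_le_of_lt hlt] using hp i hlt
      · simpa [hn] using hab
  classical
  obtain ⟨p, h0, hn, hp⟩ := Nat.find_spec hex
  refine ⟨Nat.find hex, p, h0, hn, hp, fun i j hij hj heq => ?_⟩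
  -- Cutting out the segment between the equal vertices `p i` and `p j` shortens the walk by `j -
  -- i`.
  refine Nat.find_min hex (m := Nat.find hex - (j - i)) (by omega)
    ⟨fun k => if k ≤ i then p k else p (k + (j - i)), by simp [h0], ?_, fun k hk => ?_⟩
  · by_cases hle : Nat.find hex - (j - i) ≤ i
    · have h1 : j = Nat.find hex := by omega
      have h2 : Nat.find hex - (j - i) = i := by omega
      simp only [h2, le_refl, if_true]
      rw [heq, h1, hn]
    · have h2 : Nat.find hex - (j - i) + (j - i) = Nat.find hex := by omega
      simp only [hle, if_false, h2, hn]
  · rcases lt_trichotomy k i with hki | rfl | hki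
    · simpa [hki.le, Nat.succ_le_of_lt hki] using hp k (by omega)
    · have h2 : k + 1 + (j - k) = j + 1 := by omega
      simp only [le_refl, if_true, Nat.not_succ_le_self, if_false, h2, heq]
      exact hp j (by omega)
    · have h2 : k + 1 + (j - i) = k + (j - i) + 1 := by omega
      simp only [not_le.2 hki, if_false, not_le.2 (hki.trans (Nat.lt_succ_self k)), h2]
      exact hp _ (by omega)

lemma exists_isCycleSet_of_reach (hf : G.IsLink f x y) (h : Reach (G.restrict {f}ᶜ) x y) :
    ∃ C, IsCycleSet G C ∧ f ∈ C := by
  obtain ⟨n, p, h0, hn, hp, hinj⟩ := h.exists_injOn_walk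
  have : Nonempty β := ⟨f⟩
  choose! d hd using hp
  have hpinj : ∀ i j, i ≤ n → j ≤ n → p i = p j → i = j := by
    intro i j hi hj hij
    rcases lt_trichotomy i j with hlt | heq | hlt
    · exact absurd hij (hinj i j hlt hj)
    · exact heq
    · exact absurd hij.symm (hinj j i hlt hi)
  -- `f` takes the last index `n` and closes the path from `p n = y` back to `p 0 = x`; a loop is
  -- the case `n = 0`.
  refine ⟨_, ⟨n, fun i => p i, fun i => if (i : ℕ) < n then d i else f, ?_, ?_, ?_, rfl⟩, ?_⟩
  · intro i j hij
    exact Fin.ext (hpinj i j (by omega) (by omega) hij)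
  · intro i j hij
    simp only at hij
    split_ifs at hij with hi hj hj
    · have h1 := (hd i hi).2
      rw [hij] at h1
      rcases h1.eq_and_eq_or_eq_and_eq (hd j hj).2 with ⟨h2, -⟩ | ⟨h2, h3⟩
      · exact Fin.ext (hpinj i j (by omega) (by omega) h2)
      · have := hpinj _ _ (by omega) (by omega) h2
        have := hpinj _ _ (by omega) (by omega) h3
        omega
    · exact absurd hij (hd i hi).1
    · exact absurd hij.symm (hd j hj).1
    · exact Fin.ext (by omega)
  · intro i
    by_cases hi : (i : ℕ) < n
    · have h1 : ((i + 1 : Fin (n + 1)) : ℕ) = i + 1 := by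
        rw [Fin.val_add_one_of_lt]
        exact Fin.lt_def.2 (by simpa using hi)
      simpa [hi, h1] using (hd i hi).2
    · have h1 : i = Fin.last n := Fin.ext (by simp; omega)
      subst h1
      simpa [hn, h0] using hf.symm
  · exact ⟨Fin.last n, by simp⟩

open scoped Fin.NatCast Fin.CommRing in
lemma IsCycleSet.reach {C : Set β} (hC : IsCycleSet G C) (hf : f ∈ C) :
    ∃ x y, G.IsLink f x y ∧ Reach (G.restrict {f}ᶜ) x y := by
  obtain ⟨n, v, c, -, hc, hlink, rfl⟩ := hC
  obtain ⟨i, rfl⟩ := hf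
  refine ⟨v i, v (i + 1), hlink i, Reach.symm ?_⟩
  have key : ∀ k : ℕ, k ≤ n →
      Reach (G.restrict {c i}ᶜ) (v (i + 1)) (v (i + 1 + (k : Fin (n + 1)))) := by
    intro k
    induction k with
    | zero =>
      intro _
      rw [Nat.cast_zero, add_zero]
      exact .refl
    | succ k ih =>
      intro hk
      refine (ih (by omega)).trans (reach_of_isLink (e := c (i + 1 + (k : Fin (n + 1)))) ⟨?_, ?_⟩)
      -- Meeting `c i` again would force `n + 1 ∣ k + 1`, although `k < n`.
      · intro heq
        have h1 : i + 1 + (k : Fin (n + 1)) = i := hc heq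
        have h2 : ((k + 1 : ℕ) : Fin (n + 1)) = 0 := by
          have : i + ((k + 1 : ℕ) : Fin (n + 1)) = i + 0 := by
            push_cast
            rw [add_zero, add_comm (k : Fin (n + 1)) 1, ← add_assoc, h1]
          exact add_left_cancel this
        rw [Fin.natCast_eq_zero] at h2
        exact absurd (Nat.le_of_dvd (Nat.succ_pos k) h2) (by omega)
      · have := hlink (i + 1 + (k : Fin (n + 1)))
        rwa [add_assoc (i + 1), ← Nat.cast_succ] at this
  have h := key n le_rfl
  have h1 : i + 1 + (n : Fin (n + 1)) = i := by
    rw [add_assoc]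
    have : (1 : Fin (n + 1)) + (n : Fin (n + 1)) = ((n + 1 : ℕ) : Fin (n + 1)) := by
      push_cast; exact add_comm _ _
    rw [this, Fin.natCast_self, add_zero]
  rwa [h1] at h

/-- Deleting an edge from a cycle leaves a walk between its ends. The conjunct `f ∈ E(G)` is needed
because the closure also contains labels that are no edges. -/
lemma exists_isCycleSet_restrict_iff {F : Set β} :
    (∃ C, IsCycleSet (G.restrict F) C ∧ f ∈ C) ↔
      f ∈ F ∧ f ∈ E(G) ∧ f ∈ cycleClosure G (F \ {f}) := by
  have hres : (G.restrict F).restrict {f}ᶜ = G.restrict (F \ {f}) := by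
    rw [Graph.restrict_restrict, Set.sdiff_eq]
  constructor
  · rintro ⟨C, hC, hf⟩
    obtain ⟨x, y, hxy, h⟩ := hC.reach hf
    rw [hres] at h
    exact ⟨hxy.1, hxy.2.edge_mem, mem_cycleClosure_of_isLink hxy.2 h⟩
  · rintro ⟨hfF, hfE, h⟩
    obtain ⟨x, y, hxy⟩ := G.exists_isLink_of_mem_edgeSet hfE
    have h' := h x y hxy
    rw [← hres] at h'
    exact exists_isCycleSet_of_reach ⟨hfF, hxy⟩ h'

lemma isSpanningTree_iff {T : Set β} :
    IsSpanningTree G T ↔ IsClosureBasis (cycleClosure G) E(G) T := by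
  constructor
  · rintro ⟨⟨hTE, hacyc⟩, hspan⟩
    refine ⟨hTE, fun e _ x y hxy => hspan _ _ (reach_of_isLink hxy), fun e he hmem => ?_⟩
    obtain ⟨C, hC, -⟩ := exists_isCycleSet_restrict_iff.2 ⟨he, hTE he, hmem⟩
    exact hacyc C hC
  · intro hT
    refine ⟨⟨hT.subset, fun C hC => ?_⟩, fun u v h => ?_⟩
    · obtain ⟨n, v, c, hv, hc, hlink, hCeq⟩ := id hC
      obtain ⟨h1, -, h2⟩ := exists_isCycleSet_restrict_iff.1
        ⟨C, hC, show c 0 ∈ C from hCeq ▸ Set.mem_range_self 0⟩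
      exact hT.indep _ h1 h2
    · exact h.of_adj_imp fun a b ⟨e, he⟩ => hT.spans he.edge_mem a b he

variable [LinearOrder β] {T : Set β}

lemma internallyInactive_eq (hT : IsClosureBasis (cycleClosure G) E(G) T) :
    internallyInactive G T = inactiveIn (cycleClosure G) E(G) T := by
  ext e
  refine and_congr_right fun he => ?_
  have hself : (T \ {e}) ∪ {e} = T := by simp [he]
  constructor
  · intro hnot
    by_contra! hcon
    refine hnot ⟨⟨hT.subset he, ?_⟩, ?_⟩
    · rw [hself]
      exact isSpanningTree_iff.2 hT
    · rintro f ⟨hfE, hf⟩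
      by_cases hfT : f ∈ T
      · rcases eq_or_ne f e with rfl | hne
        · exact le_rfl
        -- Here the replacement set is just `T \ {e}`, which does not span `e`.
        · rw [Set.union_eq_self_of_subset_right (Set.singleton_subset_iff.2
            (show f ∈ T \ {e} from ⟨hfT, hne⟩)), isSpanningTree_iff] at hf
          exact absurd (hf.spans (hT.subset he)) (hT.indep e he)
      · rw [isSpanningTree_iff,
          hT.exchange_iff (cycleClosure_hasExchange G) he hfE hfT] at hf
        exact hcon f hf
  · rintro ⟨f, hf, hlt⟩ hleast
    refine absurd (hleast.2 ⟨hf.mem_ground, ?_⟩) hlt.not_ge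
    exact isSpanningTree_iff.2
      ((hT.exchange_iff (cycleClosure_hasExchange G) he hf.mem_ground hf.notMem).2 hf)

lemma externallyActive_eq (hT : IsClosureBasis (cycleClosure G) E(G) T) :
    externallyActive G T = activeOut (cycleClosure G) E(G) T := by
  ext f
  refine and_congr_right fun hfE => and_congr_right fun hfT => ?_
  -- The cycle of `f` consists of `f` and the edges of `T` that `f` can replace.
  have hmem : ∀ g, g ∈ fundCycle G T f ↔
      g ∈ T ∪ {f} ∧ g ∈ E(G) ∧ g ∈ cycleClosure G ((T ∪ {f}) \ {g}) := fun g =>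
    exists_isCycleSet_restrict_iff
  have hset : ∀ g ∈ T, (T ∪ {f}) \ {g} = insert f (T \ {g}) := by
    intro g hg
    have hne : f ≠ g := by rintro rfl; exact hfT hg
    rw [Set.union_singleton, Set.insert_sdiff_of_notMem _ (by simpa using hne)]
  have hself : f ∈ fundCycle G T f := by
    refine (hmem f).2 ⟨Or.inr rfl, hfE, ?_⟩
    rw [Set.union_singleton, Set.insert_sdiff_self_of_notMem hfT]
    exact hT.spans hfE
  constructor
  · intro hleast e he
    refine lt_of_le_of_ne (hleast.2 ((hmem e).2 ⟨Or.inl he.mem, hT.subset he.mem, ?_⟩))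
      fun h => hfT (h ▸ he.mem)
    rw [hset e he.mem]
    exact he.mem_closure
  · intro hact
    refine ⟨hself, fun g hg => ?_⟩
    obtain ⟨hgT | rfl, -, hg⟩ := (hmem g).1 hg
    · rw [hset g hgT] at hg
      exact (hact g ⟨hgT, hfE, hfT, hg⟩).le
    · exact le_rfl

end GraphClosure

end Potts

namespace Potts

/-! ### The partition function as a sum over states of a product -/

section PartitionFunction

variable {α β : Type*} {q : ℕ} {G : Graph α β} {A T : Set β} {e : β}

lemma edgeDelta_eq_zero_or_one (G : Graph α β) (σ : State G q) (e : β) :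
    edgeDelta G σ e = 0 ∨ edgeDelta G σ e = 1 := by
  unfold edgeDelta
  split_ifs <;> simp

lemma edgeDelta_eq_one_iff {σ : State G q} :
    edgeDelta G σ e = 1 ↔ ∀ i j : V(G), G.IsLink e i j → σ i = σ j := by
  unfold edgeDelta
  split_ifs with h
  · exact iff_of_true rfl h
  · exact iff_of_false zero_ne_one h

/-- The Boltzmann weight contributed by the field. -/
noncomputable def fieldWeight (b : ℂ) (G : Graph α β) (M : α → Fin q → ℂ) (σ : State G q) : ℂ :=
  ∏ᶠ v : V(G), Complex.exp (b * M v (σ v))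

/-- The finite set `S` is arbitrary so that the factorization serves both `G` and the contractions,
whose energies are rewritten on `G`. -/
lemma exp_neg_energy (hV : V(G).Finite) (b : ℂ) (J : β → ℂ) (M : α → Fin q → ℂ)
    (σ : State G q) (S : Finset β) :
    Complex.exp (-b * (-(∑ e ∈ S, J e * edgeDelta G σ e)
        - ∑ᶠ i : V(G), ∑ a : Fin q, M i a * (if a = σ i then 1 else 0))) =
      (∏ e ∈ S, (1 + (Complex.exp (b * J e) - 1) * edgeDelta G σ e)) *
        fieldWeight b G M σ := by
  have := hV.fintype
  rw [fieldWeight, finsum_eq_sum_of_fintype, finprod_eq_prod_of_fintype, ← Complex.exp_sum]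
  have hedge : ∀ e ∈ S, 1 + (Complex.exp (b * J e) - 1) * edgeDelta G σ e =
      Complex.exp (b * (J e * edgeDelta G σ e)) := by
    intro e _
    rcases edgeDelta_eq_zero_or_one G σ e with h | h <;> simp [h]
  rw [Finset.prod_congr rfl hedge, ← Complex.exp_sum, ← Complex.exp_add]
  congr 1
  rw [← Finset.mul_sum, ← Finset.mul_sum]
  simp only [mul_ite, mul_one, mul_zero, Finset.sum_ite_eq', Finset.mem_univ, if_true]
  ring

lemma zExt_eq_sum_prod (hV : V(G).Finite) (hE : E(G).Finite) (b : ℂ) (J : β → ℂ)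
    (M : α → Fin q → ℂ) :
    zExt b G J M = ∑ᶠ σ : State G q,
      (∏ e ∈ hE.toFinset, (1 + (Complex.exp (b * J e) - 1) * edgeDelta G σ e)) *
        fieldWeight b G M σ := by
  unfold zExt
  refine finsum_congr fun σ => ?_
  rw [← exp_neg_energy hV, hamiltonian, finsum_mem_eq_finite_toFinset_sum _ hE]

lemma eq_of_reach_restrict {σ : State G q} (hσ : ∀ e ∈ A, edgeDelta G σ e = 1) {u v : α}
    (h : Reach (G.restrict A) u v) (hu : u ∈ V(G)) (hv : v ∈ V(G)) : σ ⟨u, hu⟩ = σ ⟨v, hv⟩ := by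
  induction h with
  | refl => rfl
  | tail _ hab ih =>
    obtain ⟨e, he, hlink⟩ := hab
    exact (ih hlink.left_mem).trans (edgeDelta_eq_one_iff.1 (hσ e he) ⟨_, hlink.left_mem⟩
      ⟨_, hv⟩ hlink)

lemma edgeDelta_eq_one_of_mem_closure {σ : State G q} (hσ : ∀ e ∈ A, edgeDelta G σ e = 1)
    (he : e ∈ cycleClosure G A) : edgeDelta G σ e = 1 :=
  edgeDelta_eq_one_iff.2 fun i j hij => eq_of_reach_restrict hσ (he _ _ hij) i.2 j.2

/-! ### Contraction of a set of edges of a spanning subgraph -/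

lemma mem_block_restrict_iff (hA : A ⊆ T) {v w : α} :
    w ∈ block (G.restrict T) A v ↔ Reach (G.restrict A) v w := by
  rw [block, Graph.restrict_restrict, Set.inter_eq_self_of_subset_right hA]
  rfl

lemma block_restrict_eq_iff (hA : A ⊆ T) {v w : α} :
    block (G.restrict T) A v = block (G.restrict T) A w ↔ Reach (G.restrict A) v w := by
  constructor
  · intro h
    rw [← mem_block_restrict_iff hA, h, mem_block_restrict_iff hA]
    exact .refl
  · intro h
    ext x
    rw [mem_block_restrict_iff hA, mem_block_restrict_iff hA]
    exact ⟨h.symm.trans, h.trans⟩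

lemma mem_vertexSet_of_mem_block (hA : A ⊆ T) {v w : α} (hv : v ∈ V(G))
    (h : w ∈ block (G.restrict T) A v) : w ∈ V(G) := by
  rw [mem_block_restrict_iff hA] at h
  induction h with
  | refl => exact hv
  | tail _ hab _ => exact hab.choose_spec.2.right_mem

/-- The vertex of the contraction into which a vertex is merged. -/
def mergeVertex (G : Graph α β) (T A : Set β) (v : V(G)) : V(contract (G.restrict T) A) :=
  ⟨block (G.restrict T) A v, Set.mem_image_of_mem _ v.2⟩

lemma mergeVertex_surjective : Function.Surjective (mergeVertex G T A) := by
  rintro ⟨_, v, hv, rfl⟩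
  exact ⟨⟨v, hv⟩, rfl⟩

lemma mergeVertex_eq_iff (hA : A ⊆ T) {v w : V(G)} :
    mergeVertex G T A v = mergeVertex G T A w ↔ Reach (G.restrict A) v w := by
  rw [← block_restrict_eq_iff hA]
  exact Subtype.ext_iff

/-- The state of `G` induced by a state of the contraction. -/
def pullState (G : Graph α β) (T A : Set β) (τ : State (contract (G.restrict T) A) q) :
    State G q :=
  fun v => τ (mergeVertex G T A v)

lemma pullState_injective :
    Function.Injective (pullState G T A : State (contract (G.restrict T) A) q → State G q) :=
  fun _ _ h => mergeVertex_surjective.injective_comp_right h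

lemma range_pullState (hA : A ⊆ T) :
    Set.range (pullState G T A : State (contract (G.restrict T) A) q → State G q) =
      {σ | ∀ e ∈ A, edgeDelta G σ e = 1} := by
  ext σ
  constructor
  · rintro ⟨τ, rfl⟩ e he
    refine edgeDelta_eq_one_iff.2 fun i j hij => congrArg τ ?_
    exact (mergeVertex_eq_iff hA).2 (reach_of_isLink ⟨he, hij⟩)
  · intro hσ
    refine ⟨fun B => σ (mergeVertex_surjective B).choose, funext fun v => ?_⟩
    exact eq_of_reach_restrict hσ ((mergeVertex_eq_iff hA).1
      (mergeVertex_surjective (mergeVertex G T A v)).choose_spec) _ v.2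

lemma edgeDelta_pullState (heT : e ∈ T) (heA : e ∉ A)
    (τ : State (contract (G.restrict T) A) q) :
    edgeDelta (contract (G.restrict T) A) τ e = edgeDelta G (pullState G T A τ) e := by
  have hiff : edgeDelta (contract (G.restrict T) A) τ e = 1 ↔
      edgeDelta G (pullState G T A τ) e = 1 := by
    rw [edgeDelta_eq_one_iff, edgeDelta_eq_one_iff]
    constructor
    · intro h i j hij
      exact h (mergeVertex G T A i) (mergeVertex G T A j)
        ⟨i, j, ⟨⟨heT, hij⟩, heA⟩, rfl, rfl⟩
    · rintro h ⟨_, hi⟩ ⟨_, hj⟩ ⟨u, v, ⟨⟨-, huv⟩, -⟩, rfl, rfl⟩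
      exact h ⟨u, huv.left_mem⟩ ⟨v, huv.right_mem⟩ huv
  rcases edgeDelta_eq_zero_or_one (contract (G.restrict T) A) τ e with h | h
  · rcases edgeDelta_eq_zero_or_one G (pullState G T A τ) e with h' | h'
    · rw [h, h']
    · rw [h', hiff.2 h']
  · rw [h, hiff.1 h]

open Classical in
lemma mergedField_apply [Fintype V(G)] (hA : A ⊆ T) (M : α → Fin q → ℂ)
    (B : V(contract (G.restrict T) A)) (a : Fin q) :
    mergedField M (B : Set α) a = ∑ v : V(G) with mergeVertex G T A v = B, M v a := by
  have hB : (B : Set α) = ((Finset.univ.filter fun v : V(G) => mergeVertex G T A v = B).map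
      (Function.Embedding.subtype _) : Finset α) := by
    obtain ⟨u, rfl⟩ := mergeVertex_surjective B
    ext w
    simp only [Finset.coe_map, Function.Embedding.coe_subtype, Finset.coe_filter,
      Finset.mem_univ, true_and, Set.mem_image, Set.mem_ofPred_eq, mergeVertex_eq_iff hA]
    constructor
    · intro hw
      exact ⟨⟨w, mem_vertexSet_of_mem_block hA u.2 hw⟩,
        ((mem_block_restrict_iff hA).1 hw).symm, rfl⟩
    · rintro ⟨v, hv, rfl⟩
      exact (mem_block_restrict_iff hA).2 hv.symm
  rw [mergedField]
  conv_lhs => rw [hB]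
  rw [finsum_mem_coe_finset, Finset.sum_map, Finset.sum_apply]
  rfl

lemma hamiltonian_contract (hV : V(G).Finite) (hA : A ⊆ T) {S : Finset β}
    (hS : (S : Set β) = T \ A) (hT : T ⊆ E(G)) (J : β → ℂ) (M : α → Fin q → ℂ)
    (τ : State (contract (G.restrict T) A) q) :
    hamiltonian (contract (G.restrict T) A) J (mergedField M) τ =
      -(∑ e ∈ S, J e * edgeDelta G (pullState G T A τ) e)
        - ∑ᶠ i : V(G), ∑ a : Fin q, M i a * (if a = pullState G T A τ i then 1 else 0) := by
  classical
  have := hV.fintype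
  have : Fintype V(contract (G.restrict T) A) := Fintype.ofSurjective _ mergeVertex_surjective
  have hedges : E(contract (G.restrict T) A) = S := by
    rw [hS]
    show (E(G) ∩ T) \ A = T \ A
    rw [Set.inter_eq_self_of_subset_right hT]
  rw [hamiltonian, hedges, finsum_mem_coe_finset, finsum_eq_sum_of_fintype,
    finsum_eq_sum_of_fintype]
  congr 1
  · congr 1
    refine Finset.sum_congr rfl fun e he => ?_
    have he' : e ∈ T \ A := hS ▸ Finset.mem_coe.2 he
    rw [edgeDelta_pullState he'.1 he'.2]
  -- A pulled-back state is constant on each merged block, so the fields add up there.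
  · rw [← Finset.sum_fiberwise Finset.univ (mergeVertex G T A)]
    refine Finset.sum_congr rfl fun B _ => ?_
    rw [Finset.sum_comm]
    refine Finset.sum_congr rfl fun a _ => ?_
    rw [mergedField_apply hA, Finset.sum_mul]
    refine Finset.sum_congr rfl fun v hv => ?_
    rw [pullState, (Finset.mem_filter.1 hv).2]

/-- The partition function of a contraction is a sum over the states of `G` that are constant
along the contracted edges. -/
lemma zExt_contract (hV : V(G).Finite) (hA : A ⊆ T) {S : Finset β}
    (hS : (S : Set β) = T \ A) (hT : T ⊆ E(G)) (b : ℂ) (J : β → ℂ) (M : α → Fin q → ℂ) :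
    zExt b (contract (G.restrict T) A) J (mergedField M) =
      ∑ᶠ σ ∈ {σ : State G q | ∀ e ∈ A, edgeDelta G σ e = 1},
        (∏ e ∈ S, (1 + (Complex.exp (b * J e) - 1) * edgeDelta G σ e)) *
          fieldWeight b G M σ := by
  rw [← range_pullState hA, finsum_mem_range pullState_injective, zExt]
  refine finsum_congr fun τ => ?_
  rw [hamiltonian_contract hV hA hS hT, exp_neg_energy hV]

-- The deltas over the inactive edges act as the indicator of the states of the contraction. On
-- these the delta of every active edge is `1`; for any other state both sides vanish.
open Classical in
lemma tree_term_eq [LinearOrder β] (hV : V(G).Finite) [Fintype (State G q)] (E : Finset β)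
    (hE : E(G) = E) (T : Finset β) (hT : IsClosureBasis (cycleClosure G) E(G) T)
    (b : ℂ) (J : β → ℂ) (M : α → Fin q → ℂ) :
    (∏ᶠ e ∈ internallyInactive G T, (Complex.exp (b * J e) - 1)) *
        (∏ᶠ e ∈ externallyActive G T, Complex.exp (b * J e)) *
          zExt b (contract (G.restrict T) (internallyInactive G T)) J (mergedField M) =
      ∑ σ : State G q,
        (∏ e ∈ T with e ∈ inactiveIn (cycleClosure G) E(G) T,
            (Complex.exp (b * J e) - 1) * edgeDelta G σ e) *
          ((∏ e ∈ E with e ∈ activeOut (cycleClosure G) E(G) T,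
              (1 + (Complex.exp (b * J e) - 1) * edgeDelta G σ e)) *
            ∏ e ∈ T with e ∉ inactiveIn (cycleClosure G) E(G) T,
              (1 + (Complex.exp (b * J e) - 1) * edgeDelta G σ e)) *
        fieldWeight b G M σ := by
  rw [internallyInactive_eq hT, externallyActive_eq hT]
  set I := inactiveIn (cycleClosure G) E(G) T
  set O := activeOut (cycleClosure G) E(G) T with hO
  have hIT : I ⊆ T := fun e he => he.1
  have hOE : O ⊆ E := fun e he => hE ▸ he.1
  have hIcoe : I = (T.filter (· ∈ I) : Finset β) := by
    ext e
    simpa using fun he => hIT he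
  have hOcoe : O = (E.filter (· ∈ O) : Finset β) := by
    ext e
    simpa using fun he => hOE he
  have hScoe : ((T.filter (· ∉ I) : Finset β) : Set β) = (T : Set β) \ I := by
    ext e
    simp
  rw [zExt_contract hV hIT hScoe hT.subset]
  have hfin : E(G).Finite := hE ▸ E.finite_toSet
  have hprodI : ∏ᶠ e ∈ I, (Complex.exp (b * J e) - 1) =
      ∏ e ∈ T with e ∈ I, (Complex.exp (b * J e) - 1) := by
    conv_lhs => rw [hIcoe]
    rw [finprod_mem_coe_finset]
  have hprodO : ∏ᶠ e ∈ O, Complex.exp (b * J e) = ∏ e ∈ E with e ∈ O, Complex.exp (b * J e) := by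
    conv_lhs => rw [hOcoe]
    rw [finprod_mem_coe_finset]
  rw [hprodI, hprodO, finsum_mem_def, finsum_eq_sum_of_fintype, Finset.mul_sum]
  refine Finset.sum_congr rfl fun σ _ => ?_
  by_cases hσ : ∀ e ∈ I, edgeDelta G σ e = 1
  · rw [Set.indicator_of_mem (show σ ∈ {σ : State G q | ∀ e ∈ I, edgeDelta G σ e = 1} from hσ)]
    have h1 : ∏ e ∈ T with e ∈ I, (Complex.exp (b * J e) - 1) * edgeDelta G σ e =
        ∏ e ∈ T with e ∈ I, (Complex.exp (b * J e) - 1) :=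
      Finset.prod_congr rfl fun e he => by rw [hσ e (Finset.mem_filter.1 he).2, mul_one]
    have h2 : ∏ e ∈ E with e ∈ O, (1 + (Complex.exp (b * J e) - 1) * edgeDelta G σ e) =
        ∏ e ∈ E with e ∈ O, Complex.exp (b * J e) := by
      refine Finset.prod_congr rfl fun e he => ?_
      rw [edgeDelta_eq_one_of_mem_closure hσ (activeOut_subset_closure
        (cycleClosure_hasExchange G) hfin hT (Finset.mem_filter.1 he).2)]
      ring
    rw [h1, h2]
    ring
  · rw [Set.indicator_of_notMem (show σ ∉ {σ : State G q | ∀ e ∈ I, edgeDelta G σ e = 1} from hσ)]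
    push Not at hσ
    obtain ⟨e, he, hne⟩ := hσ
    have h0 : ∏ e ∈ T with e ∈ I, (Complex.exp (b * J e) - 1) * edgeDelta G σ e = 0 :=
      Finset.prod_eq_zero (Finset.mem_filter.2 ⟨hIT he, he⟩)
        (by rw [(edgeDelta_eq_zero_or_one G σ e).resolve_right hne, mul_zero])
    rw [h0]
    ring

end PartitionFunction

end Potts

theorem theoremt {α β : Type*} [LinearOrder β] (G : Graph α β)
    (hV : G.vertexSet.Finite) (hE : G.edgeSet.Finite)
    (q : ℕ) (b : ℂ) (J : β → ℂ) (M : α → Fin q → ℂ) :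
    Potts.zExt b G J M =
      ∑ᶠ T ∈ {T : Set β | Potts.IsSpanningTree G T},
        (∏ᶠ e ∈ Potts.internallyInactive G T, (Complex.exp (b * J e) - 1)) *
          (∏ᶠ e ∈ Potts.externallyActive G T, Complex.exp (b * J e)) *
            Potts.zExt b (Potts.contract (G.restrict T) (Potts.internallyInactive G T)) J
              (Potts.mergedField M) := by
  classical
  have := hV.fintype
  obtain ⟨E, hEE⟩ := hE.exists_finset_coe
  have htrees : {T : Set β | Potts.IsSpanningTree G T} =
      ((E.powerset.filter fun T : Finset β =>
        Potts.IsClosureBasis (Potts.cycleClosure G) (E : Set β) (T : Set β)).map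
          Finset.coeEmb.toEmbedding : Finset (Set β)) := by
    ext T
    simp only [Set.mem_ofPred_eq, Potts.isSpanningTree_iff, Finset.coe_map, Set.mem_image,
      Finset.mem_coe, Finset.mem_filter, Finset.mem_powerset, hEE]
    constructor
    · intro hT
      obtain ⟨T', rfl⟩ := (hE.subset hT.subset).exists_finset_coe
      exact ⟨T', ⟨Finset.coe_subset.1 (hEE ▸ hT.subset), hT⟩, rfl⟩
    · rintro ⟨T', ⟨-, hT⟩, rfl⟩
      exact hT
  rw [htrees, finsum_mem_coe_finset, Finset.sum_map, Potts.zExt_eq_sum_prod hV hE,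
    finsum_eq_sum_of_fintype]
  have hterm := fun (T : Finset β) (hT : T ∈ E.powerset.filter fun T : Finset β =>
      Potts.IsClosureBasis (Potts.cycleClosure G) (E : Set β) (T : Set β)) =>
    Potts.tree_term_eq hV E hEE.symm T (hEE ▸ (Finset.mem_filter.1 hT).2) b J M
  refine Eq.trans ?_ (Finset.sum_congr rfl hterm).symm
  -- After interchanging trees and states, the identity holds state by state.
  rw [Finset.sum_comm]
  refine Finset.sum_congr rfl fun σ _ => ?_
  have hEfin : hE.toFinset = E := by
    rw [← Finset.coe_inj, Set.Finite.coe_toFinset, hEE]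
  rw [hEfin, Potts.prod_one_add_eq_sum_bases (Potts.cycleClosure_hasExchange G), Finset.sum_mul,
    hEE]
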